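/- A differential $R$-module over a commutative ring $R$ is an $R$-module $D$ with an $R$-linear map $\delta\colon D\to D$ such that $\delta^2=0$; its homology is the $R$-module $H(D)=\operatorname{Ker}\delta/\operatorname{Im}\delta$. A morphism of differential modules is an $R$-linear map that commutes with the maps $\delta$, and $D$ is a retract of $F$ if it is a direct summand of $F$ as a differential module, that is, if there are morphisms $D\to F\to D$ with composite $\mathrm{id}_D$. A projective flag in a differential $R$-module $F$ is a family $(F^n)_{n\in\mathbb Z}$ of $R$-submodules of $F$ with $F^n\subseteq F^{n+1}$, $F^{-1}=0$, $\bigcup_n F^n=F$ and $\delta(F^n)\subseteq F^{n-1}$ for all $n$, such that every quotient $F^n/F^{n-1}$ is a projective $R$-module. For a homomorphism $R\to S$ of commutative rings, $S\otimes_R D$ is the differential $S$-module with differentiation $S\otimes_R\delta$. Theorem. Let $R\to S$ be a homomorphism of noetherian commutative rings and let $D$ be a differential $R$-module whose homology $H(D)$ is a finitely generated $R$-module. Suppose that $D$ is a retract of some differential $R$-module that admits a projective flag. Then $$\operatorname{Supp}_S H(S\otimes_R D)=\operatorname{Supp}_S(S/IS),\qquad\text{where } I=\operatorname{Ann}_R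 H(D).$$ If, in addition, the $S$-module $S\otimes_R D$ is finitely generated, then the $S$-module $H(S\otimes_R D)$ has finite length if and only if the ring $S/IS$ is artinian. -/

import Mathlib

open scoped TensorProduct

/-- A differentiation on an `R`-module `D`: an `R`-linear endomorphism of square zero. The pair
`(D, δ)` is a differential `R`-module. -/
structure Differentiation (R : Type*) [Ring R] (D : Type*) [AddCommGroup D] [Module R D] where
  /-- The underlying `R`-linear map `D → D`. -/
  toLinearMap : D →ₗ[R] D
  sq_zero : toLinearMap ∘ₗ toLinearMap = 0

namespace Differentiation

section Basic

variable {R : Type*} [Ring R] {D : Type*} [AddCommGroup D] [Module R D]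
  {F : Type*} [AddCommGroup F] [Module R F]

/-- The cycles `Z(D) = Ker δ`. -/
def cycles (δ : Differentiation R D) : Submodule R D := LinearMap.ker δ.toLinearMap

/-- The boundaries `B(D) = Im δ`. -/
def boundaries (δ : Differentiation R D) : Submodule R D := LinearMap.range δ.toLinearMap

theorem boundaries_le_cycles (δ : Differentiation R D) : δ.boundaries ≤ δ.cycles :=
  LinearMap.range_le_ker_iff.mpr δ.sq_zero

/-- The homology `H(D) = Z(D) / B(D)`, an `R`-module. -/
abbrev Homology (δ : Differentiation R D) : Type _ :=
  δ.cycles ⧸ δ.boundaries.submoduleOf δ.cycles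

/-- A morphism of differential modules: a linear map that commutes with the differentiations. -/
def IsMorphism (δ : Differentiation R D) (ε : Differentiation R F) (f : D →ₗ[R] F) : Prop :=
  f ∘ₗ δ.toLinearMap = ε.toLinearMap ∘ₗ f

/-- `(D, δ)` is a retract of `(F, ε)`: a direct summand as a differential module, that is, there
are morphisms of differential modules `D → F → D` whose composite is the identity. -/
def IsRetract (δ : Differentiation R D) (ε : Differentiation R F) : Prop :=
  ∃ (i : D →ₗ[R] F) (p : F →ₗ[R] D),
    IsMorphism δ ε i ∧ IsMorphism ε δ p ∧ p ∘ₗ i = LinearMap.id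

/-- A differential flag in `(F, δ)`: an increasing exhaustive family of submodules `Fⁿ`, indexed by
the integers, with `F⁻¹ = 0` and `δ(Fⁿ) ⊆ Fⁿ⁻¹` for every `n`. -/
structure Flag (δ : Differentiation R F) where
  /-- The submodule `Fⁿ`. -/
  filt : ℤ → Submodule R F
  filt_le : ∀ n, filt n ≤ filt (n + 1)
  filt_neg_one : filt (-1) = ⊥
  exhaustive : ∀ x : F, ∃ n, x ∈ filt n
  map_le : ∀ n, (filt n).map δ.toLinearMap ≤ filt (n - 1)

/-- The `n`-th fold `Fⁿ / Fⁿ⁻¹` of a differential flag. -/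
abbrev Flag.Fold {δ : Differentiation R F} (𝓕 : Flag δ) (n : ℤ) : Type _ :=
  𝓕.filt n ⧸ (𝓕.filt (n - 1)).submoduleOf (𝓕.filt n)

/-- A flag is projective if every fold is a projective module. -/
def Flag.IsProjective {δ : Differentiation R F} (𝓕 : Flag δ) : Prop :=
  ∀ n, Module.Projective R (𝓕.Fold n)

/-- The differential module `(F, δ)` admits a projective flag. -/
def AdmitsProjectiveFlag (δ : Differentiation R F) : Prop :=
  ∃ 𝓕 : Flag δ, 𝓕.IsProjective

end Basic

section BaseChange

variable {R : Type*} [CommRing R] (S : Type*) [CommRing S] [Algebra R S]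
  {D : Type*} [AddCommGroup D] [Module R D]

/-- The differential `S`-module `S ⊗ D`, with differentiation `s ⊗ x ↦ s ⊗ δ x`. -/
def baseChange (δ : Differentiation R D) : Differentiation S (S ⊗[R] D) where
  toLinearMap := δ.toLinearMap.baseChange S
  sq_zero := by
    rw [← LinearMap.baseChange_comp, δ.sq_zero, LinearMap.baseChange_zero]

end BaseChange

end Differentiation

/-! Let `q` be a prime of `S` lying over `p` in `R`. Homology commutes with localization, so `q` is
outside the support of `H(S ⊗ D)` exactly when `S_q ⊗ D` is acyclic. The support formula thus says
that `S_q ⊗ D` is acyclic if and only if `R_p ⊗ D` is: as `H(D)` is finitely generated, its support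
is `V(I)`, whose preimage in `Spec S` is `V(IS)`.

From `R_p` to `S_q`: homotopies can be built fold by fold along a projective flag, so every morphism
from `D` to an acyclic module is null-homotopic. A null-homotopy of `D → R_p ⊗ D` contracts `M ⊗ D`
for every `R_p`-module `M`, in particular for `M = S_q` (`IsRetract.exact_lTensor`).

From `S_q` to `R_p`: the same argument over `S_q` makes `κ(q) ⊗ D` acyclic, hence also its direct
summand `κ(p) ⊗ D`. It remains to lift acyclicity from the residue field to the local ring
(`exact_of_exact_residueField`). This is a noetherian induction on the ideal of null-homotopic
multiplications. If that ideal misses an element `x` of the maximal ideal, the cone of `x` has a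
larger ideal and is acyclic by induction; then `x` is surjective on the finitely generated homology,
and Nakayama kills it. Otherwise a dévissage through the quotients by all ideals lifts acyclicity by
flatness (`exact_lTensor_quotient`).

Finite length of a finite module over a noetherian ring only depends on whether its support consists
of maximal ideals, so the second claim follows from the first. -/

namespace Differentiation

/-! ### Projective flags: projectivity and null-homotopies -/

section Flag

variable {R : Type*} [Ring R] {F : Type*} [AddCommGroup F] [Module R F]
  {A : Type*} [AddCommGroup A] [Module R A]

theorem Flag.filt_mono {ε : Differentiation R F} (𝓕 : Flag ε) : Monotone 𝓕.filt :=
  monotone_int_of_le_succ 𝓕.filt_le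

/-- A linear map on the total module of a flag can be built one step at a time. -/
theorem Flag.exists_linearMap {ε : Differentiation R F} (𝓕 : Flag ε)
    (Q : (F →ₗ.[R] A) → Prop) (bot : ∀ g, g.domain = ⊥ → Q g)
    (step : ∀ n g, g.domain = 𝓕.filt (n - 1) → Q g → ∃ g', g'.domain = 𝓕.filt n ∧ g ≤ g' ∧ Q g') :
    ∃ h : F →ₗ[R] A, ∀ x, ∃ g, Q g ∧ x ∈ g.domain ∧ ∀ y : g.domain, g y = h y := by
  -- The shift by one starts the recursion at `F⁻¹ = 0`, where the zero map is the only choice.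
  let T (n : ℕ) := {g : F →ₗ.[R] A // g.domain = 𝓕.filt ((n : ℤ) - 1) ∧ Q g}
  have stepT (n : ℕ) (g : T n) : ∃ g' : T (n + 1), g.1 ≤ g'.1 := by
    obtain ⟨g', h1, h2, h3⟩ := step n g.1 g.2.1 g.2.2
    exact ⟨⟨g', by simpa using h1, h3⟩, h2⟩
  choose next hnext using stepT
  let c (n : ℕ) : T n :=
    Nat.rec ⟨⊥, 𝓕.filt_neg_one.symm, bot _ rfl⟩ (fun n g => next n g) n
  have hmono : Monotone fun n => (c n).1 := monotone_nat_of_le_succ fun n => hnext n (c n)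
  have hdir : DirectedOn (· ≤ ·) (Set.range fun n => (c n).1) :=
    directedOn_range.mpr hmono.directed_le
  let H := LinearPMap.sSup _ hdir
  have hx (x : F) : ∃ n : ℕ, x ∈ (c n).1.domain := by
    obtain ⟨n, hn⟩ := 𝓕.exhaustive x
    refine ⟨(n + 1).toNat, ?_⟩
    rw [(c _).2.1]
    exact 𝓕.filt_mono (by omega) hn
  have htop : H.domain = ⊤ := by
    rw [eq_top_iff]
    intro x _
    obtain ⟨n, hn⟩ := hx x
    exact (LinearPMap.le_sSup hdir ⟨n, rfl⟩).1 hn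
  refine ⟨H.toFun ∘ₗ LinearMap.codRestrict H.domain LinearMap.id (fun x => htop ▸ trivial),
    fun x => ?_⟩
  obtain ⟨n, hn⟩ := hx x
  exact ⟨(c n).1, (c n).2.2, hn, fun y => (LinearPMap.sSup_apply hdir ⟨n, rfl⟩ y).symm⟩

/-- Extension of a linear map from `Fⁿ⁻¹` to `Fⁿ` by a linear map on the fold, along a section
`s` of the projection to the fold. -/
theorem Flag.exists_extension {ε : Differentiation R F} (𝓕 : Flag ε) (n : ℤ)
    (s : 𝓕.Fold n →ₗ[R] 𝓕.filt n) (hs : ∀ c, Submodule.Quotient.mk (s c) = c)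
    (g : 𝓕.filt (n - 1) →ₗ[R] A) (u : 𝓕.Fold n →ₗ[R] A) :
    ∃ g' : 𝓕.filt n →ₗ[R] A,
      (LinearPMap.mk _ g ≤ LinearPMap.mk _ g') ∧
      ∀ x : 𝓕.filt n, ∃ y : 𝓕.filt (n - 1), ∃ c, (x : F) = y + s c ∧ g' x = g y + u c := by
  let π := ((𝓕.filt (n - 1)).submoduleOf (𝓕.filt n)).mkQ
  -- The section splits `Fⁿ` as the direct sum of `Fⁿ⁻¹` and the image of `s`; `q` is the projection
  -- to the first summand.
  let q : 𝓕.filt n →ₗ[R] 𝓕.filt n := LinearMap.id - s ∘ₗ π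
  have hmem (x : 𝓕.filt n) : (q x : F) ∈ 𝓕.filt (n - 1) := by
    have : q x ∈ (𝓕.filt (n - 1)).submoduleOf (𝓕.filt n) := by
      rw [← Submodule.Quotient.mk_eq_zero]
      simp [q, π, hs]
    exact this
  let r : 𝓕.filt n →ₗ[R] 𝓕.filt (n - 1) :=
    LinearMap.codRestrict _ ((𝓕.filt n).subtype ∘ₗ q) hmem
  have hr (x : 𝓕.filt n) : (r x : F) = x - s (π x) := rfl
  refine ⟨g ∘ₗ r + u ∘ₗ π, ⟨𝓕.filt_mono (by omega), fun x y hxy => ?_⟩,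
    fun x => ⟨r x, π x, by rw [hr, sub_add_cancel], rfl⟩⟩
  have hπ : π y = 0 := by
    rw [Submodule.mkQ_apply, Submodule.Quotient.mk_eq_zero]
    change (y : F) ∈ 𝓕.filt (n - 1)
    exact hxy ▸ x.2
  have hry : r y = x := Subtype.ext (by rw [hr, hπ, map_zero, ZeroMemClass.coe_zero, sub_zero, hxy])
  change g x = g (r y) + u (π y)
  rw [hry, hπ, map_zero, add_zero]

theorem Flag.IsProjective.exists_section {ε : Differentiation R F} {𝓕 : Flag ε}
    (h𝓕 : 𝓕.IsProjective) (n : ℤ) :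
    ∃ s : 𝓕.Fold n →ₗ[R] 𝓕.filt n, ∀ c, Submodule.Quotient.mk (s c) = c := by
  have := h𝓕 n
  obtain ⟨s, hs⟩ := Module.projective_lifting_property
    ((𝓕.filt (n - 1)).submoduleOf (𝓕.filt n)).mkQ LinearMap.id (Submodule.mkQ_surjective _)
  exact ⟨s, fun c => LinearMap.congr_fun hs c⟩

/-- Every inclusion of `Fⁿ⁻¹` in `Fⁿ` splits, so a section of a surjection from a free module onto
`F` can be extended one fold at a time. -/
theorem AdmitsProjectiveFlag.projective {ε : Differentiation R F} (hε : ε.AdmitsProjectiveFlag) :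
    Module.Projective R F := by
  obtain ⟨𝓕, h𝓕⟩ := hε
  refine Module.Projective.of_lifting_property'' fun f hf => ?_
  obtain ⟨h, hh⟩ := 𝓕.exists_linearMap (A := F →₀ R) (fun g => ∀ x : g.domain, f (g x) = x)
    (by
      rintro ⟨_, g⟩ rfl ⟨x, hx⟩
      obtain rfl := (Submodule.mem_bot R).mp hx
      change f (g 0) = 0
      simp)
    (by
      rintro n ⟨_, g⟩ rfl hg
      obtain ⟨s, hs⟩ := h𝓕.exists_section n
      have := h𝓕 n
      obtain ⟨u, hu⟩ := Module.projective_lifting_property f ((𝓕.filt n).subtype ∘ₗ s) hf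
      obtain ⟨g', hle, hg'⟩ := 𝓕.exists_extension n s hs g u
      refine ⟨⟨_, g'⟩, rfl, hle, fun x => ?_⟩
      obtain ⟨y, c, hx, hgx⟩ := hg' x
      have h1 : f (g y) = y := hg y
      have h2 : f (u c) = s c := LinearMap.congr_fun hu c
      change f (g' x) = x
      rw [hgx, map_add, h1, h2, hx])
  refine ⟨h, LinearMap.ext fun x => ?_⟩
  obtain ⟨g, hg, hx, hgh⟩ := hh x
  have := hg ⟨x, hx⟩
  rwa [hgh] at this

/-- A morphism from a differential module with a projective flag to an acyclic differential module
is null-homotopic. -/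
theorem AdmitsProjectiveFlag.exists_homotopy {ε : Differentiation R F}
    (hε : ε.AdmitsProjectiveFlag) (a : A →ₗ[R] A) (ha : Function.Exact a a) (f : F →ₗ[R] A)
    (hf : f ∘ₗ ε.toLinearMap = a ∘ₗ f) :
    ∃ h : F →ₗ[R] A, a ∘ₗ h + h ∘ₗ ε.toLinearMap = f := by
  obtain ⟨𝓕, h𝓕⟩ := hε
  have hεε (x : F) : ε.toLinearMap (ε.toLinearMap x) = 0 := LinearMap.congr_fun ε.sq_zero x
  have hfx (x : F) : f (ε.toLinearMap x) = a (f x) := LinearMap.congr_fun hf x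
  obtain ⟨h, hh⟩ := 𝓕.exists_linearMap (A := A) (fun g => ∀ x : g.domain,
      ∃ y : g.domain, (y : F) = ε.toLinearMap x ∧ a (g x) + g y = f x)
    (by
      rintro ⟨_, g⟩ rfl ⟨x, hx⟩
      obtain rfl := (Submodule.mem_bot R).mp hx
      refine ⟨0, by simp, ?_⟩
      change a (g 0) + g 0 = f 0
      simp)
    (by
      rintro n ⟨_, g⟩ rfl hg
      obtain ⟨s, hs⟩ := h𝓕.exists_section n
      have hmem (x : 𝓕.filt n) : ε.toLinearMap x ∈ 𝓕.filt (n - 1) :=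
        𝓕.map_le n (Submodule.mem_map_of_mem x.2)
      let e : 𝓕.filt n →ₗ[R] 𝓕.filt (n - 1) :=
        LinearMap.codRestrict _ (ε.toLinearMap ∘ₗ (𝓕.filt n).subtype) hmem
      -- The homotopy on `Fⁿ` must send `x` to a preimage under `a` of `f x - g (ε x)`. This element
      -- is a cycle by the homotopy identity on `Fⁿ⁻¹` and `ε² = 0`, hence a boundary; projectivity
      -- of the fold then chooses preimages linearly.
      have key (x : 𝓕.filt n) : f x - g (e x) ∈ LinearMap.range a := by
        apply (ha _).mp
        obtain ⟨y, hy, hyg⟩ := hg (e x)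
        have hy0 : y = 0 := Subtype.ext (by rw [hy]; exact hεε x)
        have h2 : a (g (e x)) + g y = f (e x) := hyg
        rw [hy0, map_zero, add_zero] at h2
        rw [map_sub, h2, ← hfx]
        exact sub_self _
      let w : 𝓕.Fold n →ₗ[R] LinearMap.range a :=
        LinearMap.codRestrict _ ((f ∘ₗ (𝓕.filt n).subtype - g ∘ₗ e) ∘ₗ s) fun c => key (s c)
      have := h𝓕 n
      obtain ⟨u, hu⟩ := Module.projective_lifting_property a.rangeRestrict w
        a.surjective_rangeRestrict
      obtain ⟨g', hle, hg'⟩ := 𝓕.exists_extension n s hs g u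
      refine ⟨⟨_, g'⟩, rfl, hle, fun x => ?_⟩
      obtain ⟨y, c, hx, hgx⟩ := hg' x
      have hau : a (u c) = f (s c) - g (e (s c)) :=
        congrArg Subtype.val (LinearMap.congr_fun hu c)
      refine ⟨⟨e x, 𝓕.filt_mono (by omega) (e x).2⟩, rfl, ?_⟩
      have hge : g' ⟨e x, 𝓕.filt_mono (by omega) (e x).2⟩ = g (e x) :=
        (hle.2 (x := e x) (y := ⟨e x, 𝓕.filt_mono (by omega) (e x).2⟩) rfl).symm
      obtain ⟨y', hy', hyg⟩ := hg y
      have hyg' : a (g y) + g y' = f y := hyg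
      have hex : e x = y' + e (s c) := by
        ext
        change ε.toLinearMap x = y' + ε.toLinearMap (s c)
        rw [hy', hx, map_add]
      change a (g' x) + g' ⟨e x, _⟩ = f x
      rw [hge, hgx, hx, hex, map_add, map_add, map_add, hau, ← hyg']
      abel)
  refine ⟨h, LinearMap.ext fun x => ?_⟩
  obtain ⟨g, hg, hx, hgh⟩ := hh x
  obtain ⟨y, hy, hy'⟩ := hg ⟨x, hx⟩
  rw [hgh, hgh, hy] at hy'
  exact hy'

variable {D : Type*} [AddCommGroup D] [Module R D]

theorem IsRetract.projective {δ : Differentiation R D} {ε : Differentiation R F}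
    (hret : δ.IsRetract ε) (hε : ε.AdmitsProjectiveFlag) : Module.Projective R D := by
  obtain ⟨i, p, -, -, hpi⟩ := hret
  have := hε.projective
  exact Module.Projective.of_split i p hpi

theorem IsRetract.exists_homotopy {δ : Differentiation R D} {ε : Differentiation R F}
    (hret : δ.IsRetract ε) (hε : ε.AdmitsProjectiveFlag)
    (a : A →ₗ[R] A) (ha : Function.Exact a a) (f : D →ₗ[R] A)
    (hf : f ∘ₗ δ.toLinearMap = a ∘ₗ f) :
    ∃ h : D →ₗ[R] A, a ∘ₗ h + h ∘ₗ δ.toLinearMap = f := by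
  obtain ⟨i, p, hi, hp, hpi⟩ := hret
  obtain ⟨h, hh⟩ := hε.exists_homotopy a ha (f ∘ₗ p) (by
    rw [LinearMap.comp_assoc, hp, ← LinearMap.comp_assoc, hf, LinearMap.comp_assoc])
  refine ⟨h ∘ₗ i, ?_⟩
  rw [LinearMap.comp_assoc, hi, ← LinearMap.comp_assoc, ← LinearMap.comp_assoc,
    ← LinearMap.add_comp, hh, LinearMap.comp_assoc, hpi, LinearMap.comp_id]

end Flag

end Differentiation

namespace Differentiation

/-! ### Short exact sequences of differential modules -/

section Exact

variable {R : Type*} [Ring R] {A B C : Type*} [AddCommGroup A] [Module R A] [AddCommGroup B]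
  [Module R B] [AddCommGroup C] [Module R C] {a : A →ₗ[R] A} {b : B →ₗ[R] B} {c : C →ₗ[R] C}
  {i : A →ₗ[R] B} {p : B →ₗ[R] C}

/-- In a short exact sequence of differential modules `0 → A → B → C → 0` with `C` acyclic, every
cycle of `B` is homologous to a cycle of `A`. -/
theorem exists_cycle_of_exact (hi : Function.Injective i) (hip : Function.Exact i p)
    (hp : Function.Surjective p) (hia : i ∘ₗ a = b ∘ₗ i) (hpb : p ∘ₗ b = c ∘ₗ p)
    (hb : b ∘ₗ b = 0) (hc : Function.Exact c c) {z : B} (hz : b z = 0) :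
    ∃ z' y, a z' = 0 ∧ z = i z' + b y := by
  have hia (x : A) : i (a x) = b (i x) := LinearMap.congr_fun hia x
  have hpb (x : B) : p (b x) = c (p x) := LinearMap.congr_fun hpb x
  have hb (x : B) : b (b x) = 0 := LinearMap.congr_fun hb x
  obtain ⟨w, hw⟩ := (hc (p z)).mp (by rw [← hpb, hz, map_zero])
  obtain ⟨y, rfl⟩ := hp w
  obtain ⟨z', hz'⟩ := (hip (z - b y)).mp (by rw [map_sub, hpb, hw, sub_self])
  refine ⟨z', y, hi ?_, by rw [hz', sub_add_cancel]⟩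
  rw [hia, hz', map_sub, hz, hb, sub_self, map_zero]

/-- In a short exact sequence of differential modules, the middle term is acyclic if both outer
terms are. -/
theorem exact_of_exact (hi : Function.Injective i) (hip : Function.Exact i p)
    (hp : Function.Surjective p) (hia : i ∘ₗ a = b ∘ₗ i) (hpb : p ∘ₗ b = c ∘ₗ p)
    (hb : b ∘ₗ b = 0) (ha : Function.Exact a a) (hc : Function.Exact c c) :
    Function.Exact b b := by
  intro z
  refine ⟨fun hz => ?_, ?_⟩
  · obtain ⟨z', y, hz', rfl⟩ := exists_cycle_of_exact hi hip hp hia hpb hb hc hz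
    obtain ⟨w, rfl⟩ := (ha z').mp hz'
    exact ⟨i w + y, by rw [map_add, ← LinearMap.comp_apply i a, hia]; rfl⟩
  · rintro ⟨y, rfl⟩
    exact LinearMap.congr_fun hb y

end Exact

/-! ### Mapping cones of multiplications and null-homotopic elements -/

section Cone

variable {R : Type*} [CommRing R] {E : Type*} [AddCommGroup E] [Module R E]

/-- The differentiation of the mapping cone of multiplication by `x`. -/
def cone (d : E →ₗ[R] E) (x : R) : E × E →ₗ[R] E × E :=
  (d ∘ₗ LinearMap.fst R E E + x • LinearMap.snd R E E).prod (-(d ∘ₗ LinearMap.snd R E E))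

theorem cone_apply (d : E →ₗ[R] E) (x : R) (e : E × E) :
    cone d x e = (d e.1 + x • e.2, -d e.2) := rfl

theorem cone_comp_cone {d : E →ₗ[R] E} (hd : d ∘ₗ d = 0) (x : R) :
    cone d x ∘ₗ cone d x = 0 := by
  have hd (e : E) : d (d e) = 0 := LinearMap.congr_fun hd e
  refine LinearMap.ext fun e => ?_
  simp [cone_apply, hd]

/-- The ideal of elements whose multiplication map is null-homotopic. -/
def nullHomotopyIdeal (d : E →ₗ[R] E) : Ideal R where
  carrier := {x | ∃ h : E →ₗ[R] E, d ∘ₗ h + h ∘ₗ d = x • LinearMap.id}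
  add_mem' := by
    rintro x y ⟨h, hh⟩ ⟨k, hk⟩
    exact ⟨h + k, by rw [add_smul, ← hh, ← hk, LinearMap.comp_add, LinearMap.add_comp]; abel⟩
  zero_mem' := ⟨0, by simp⟩
  smul_mem' := by
    rintro r x ⟨h, hh⟩
    exact ⟨r • h, by rw [smul_eq_mul, mul_smul, ← hh, smul_add, LinearMap.comp_smul,
      LinearMap.smul_comp]⟩

theorem nullHomotopyIdeal_le_cone (d : E →ₗ[R] E) (x : R) :
    nullHomotopyIdeal d ≤ nullHomotopyIdeal (cone d x) := by
  rintro y ⟨h, hh⟩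
  have hh (e : E) : d (h e) + h (d e) = y • e := LinearMap.congr_fun hh e
  refine ⟨(h ∘ₗ LinearMap.fst R E E).prod (-(h ∘ₗ LinearMap.snd R E E)), LinearMap.ext fun e => ?_⟩
  ext
  · simp [cone_apply, ← hh]
    abel
  · simp [cone_apply, ← hh]

/-- Together with `nullHomotopyIdeal_le_cone`, this makes the ideal grow strictly whenever `x` was
not yet in it, which drives the noetherian induction. -/
theorem mem_nullHomotopyIdeal_cone (d : E →ₗ[R] E) (x : R) :
    x ∈ nullHomotopyIdeal (cone d x) := by
  refine ⟨LinearMap.inr R E E ∘ₗ LinearMap.fst R E E, LinearMap.ext fun e => ?_⟩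
  ext <;> simp [cone_apply]

/-- The homology of `(E, d)` is finitely generated: the cycles are generated, modulo the
boundaries, by finitely many of them. -/
def HomologyFG (d : E →ₗ[R] E) : Prop :=
  ∃ L : Submodule R E, L.FG ∧ L ≤ LinearMap.ker d ∧ LinearMap.ker d ≤ L ⊔ LinearMap.range d

/-- The cone is an extension of `E` by `E`, so its homology is an extension of a submodule of `H(E)`
by a quotient of `H(E)`; noetherianity handles the submodule. -/
theorem HomologyFG.cone [IsNoetherianRing R] {d : E →ₗ[R] E} (hd : d ∘ₗ d = 0)
    (h : HomologyFG d) (x : R) : HomologyFG (cone d x) := by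
  have hd (e : E) : d (d e) = 0 := LinearMap.congr_fun hd e
  obtain ⟨L, hL, hLk, hkL⟩ := h
  let K := LinearMap.ker (Differentiation.cone d x) ⊓ L.comap (LinearMap.snd R E E)
  have hK : (K.map (LinearMap.snd R E E)).FG :=
    hL.of_le (by rintro _ ⟨e, he, rfl⟩; exact he.2)
  obtain ⟨t, ht⟩ := hK
  have htK : (t : Set E) ⊆ LinearMap.snd R E E '' K := by
    rw [← Submodule.map_coe, ← ht]
    exact Submodule.subset_span
  classical
  obtain ⟨t', ht', rfl⟩ := Finset.subset_set_image_iff.mp htK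
  let K' := Submodule.span R (t' : Set (E × E))
  have hK'K : K' ≤ K := Submodule.span_le.mpr ht'
  have hmap : K'.map (LinearMap.snd R E E) = K.map (LinearMap.snd R E E) := by
    rw [← ht, Submodule.map_span, Finset.coe_image]
  refine ⟨K' ⊔ L.map (LinearMap.inl R E E), Submodule.FG.sup ⟨t', rfl⟩ (hL.map _),
    sup_le (hK'K.trans inf_le_left) ?_, ?_⟩
  · rintro _ ⟨l, hl, rfl⟩
    have : d l = 0 := hLk hl
    exact Prod.ext (by simp [cone_apply, this]) (by simp [cone_apply])
  · rintro ⟨a, b⟩ hab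
    have hab' : d a + x • b = 0 ∧ d b = 0 := by simpa [cone_apply] using hab
    obtain ⟨l, hl, _, ⟨c, rfl⟩, hb⟩ := Submodule.mem_sup.mp (hkL hab'.2)
    subst hb
    -- Subtracting the boundary of `(0, -c)` from `(a, l + d c)` moves the second component into
    -- `L`.
    have hlK : (a + x • c, l) ∈ K := by
      refine ⟨?_, hl⟩
      have h1 : d l = 0 := hLk hl
      change (d (a + x • c) + x • l, -d l) = 0
      rw [h1, neg_zero, map_add, map_smul, add_assoc, ← smul_add, add_comm (d c), hab'.1]
      rfl
    have : l ∈ K'.map (LinearMap.snd R E E) := by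
      rw [hmap]
      exact ⟨_, hlK, rfl⟩
    obtain ⟨⟨a', l₁⟩, hk', hl₁⟩ := this
    change l₁ = l at hl₁
    subst l₁
    have hsub := K.sub_mem hlK (hK'K hk')
    have hcyc : d (a + x • c - a') = 0 := by
      simpa [cone_apply] using hsub.1
    obtain ⟨l', hl', _, ⟨y, rfl⟩, hy⟩ := Submodule.mem_sup.mp (hkL hcyc)
    have : (a, l + d c) = ((a', l) + (l', 0)) + Differentiation.cone d x (y, -c) := by
      ext
      · simp only [cone_apply, Prod.fst_add, smul_neg]
        rw [add_assoc, ← add_assoc l', hy]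
        abel
      · simp [cone_apply]
    change (a, l + d c) ∈ _
    rw [this]
    exact Submodule.add_mem_sup (Submodule.add_mem_sup hk' ⟨l', hl', rfl⟩) ⟨_, rfl⟩

/-- The extension of `E` by `E` given by the cone is split as a sequence of modules, so it stays
short exact under any tensor product. -/
theorem exact_lTensor_cone (M : Type*) [AddCommGroup M] [Module R M] {d : E →ₗ[R] E}
    (hd : d ∘ₗ d = 0) (x : R) (h : Function.Exact (d.lTensor M) (d.lTensor M)) :
    Function.Exact ((cone d x).lTensor M) ((cone d x).lTensor M) := by
  refine exact_of_exact (a := d.lTensor M) (c := (-d).lTensor M)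
    (i := (LinearMap.inl R E E).lTensor M) (p := (LinearMap.snd R E E).lTensor M)
    ?_ (lTensor_exact M .inl_snd LinearMap.snd_surjective)
    (LinearMap.lTensor_surjective M LinearMap.snd_surjective) ?_ ?_ ?_ h ?_
  · refine Function.LeftInverse.injective (g := (LinearMap.fst R E E).lTensor M) fun y => ?_
    rw [← LinearMap.lTensor_comp_apply, LinearMap.fst_comp_inl, LinearMap.lTensor_id_apply]
  · rw [← LinearMap.lTensor_comp, ← LinearMap.lTensor_comp]
    congr 1
    ext <;> simp [cone_apply]
  · rw [← LinearMap.lTensor_comp, ← LinearMap.lTensor_comp]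
    congr 1
  · rw [← LinearMap.lTensor_comp, cone_comp_cone hd, LinearMap.lTensor_zero]
  · intro y
    rw [LinearMap.lTensor_neg, LinearMap.neg_apply, neg_eq_zero, h y]
    constructor
    · rintro ⟨w, rfl⟩; exact ⟨-w, by simp⟩
    · rintro ⟨w, rfl⟩; exact ⟨-w, by simp⟩

end Cone

/-! ### Dévissage over the quotients of a noetherian ring -/

section Devissage

theorem lTensor_comp_self {R : Type*} [CommRing R] {E : Type*} [AddCommGroup E] [Module R E]
    {d : E →ₗ[R] E} (M : Type*) [AddCommGroup M] [Module R M] (hd : d ∘ₗ d = 0) :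
    d.lTensor M ∘ₗ d.lTensor M = 0 := by
  rw [← LinearMap.lTensor_comp, hd, LinearMap.lTensor_zero]

variable {R : Type*} [CommRing R] {E : Type*} [AddCommGroup E] [Module R E] [Module.Flat R E]
  {d : E →ₗ[R] E}

/-- Given `K = (J : x)`, multiplication by `x` from `R ⧸ K` to `R ⧸ J`. -/
def mulQuotient {K J : Ideal R} {x : R} (hK : ∀ y, y ∈ K ↔ x * y ∈ J) : (R ⧸ K) →ₗ[R] R ⧸ J :=
  Submodule.mapQ K J (LinearMap.mulLeft R x) fun y hy => (hK y).mp hy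

theorem mulQuotient_mk {K J : Ideal R} {x : R} (hK : ∀ y, y ∈ K ↔ x * y ∈ J) (y : R) :
    mulQuotient hK (Submodule.Quotient.mk y) = Submodule.Quotient.mk (x * y) := rfl

theorem mulQuotient_injective {K J : Ideal R} {x : R} (hK : ∀ y, y ∈ K ↔ x * y ∈ J) :
    Function.Injective (mulQuotient hK) := by
  rw [injective_iff_map_eq_zero]
  intro y hy
  obtain ⟨y, rfl⟩ := Submodule.mkQ_surjective K y
  rw [Submodule.mkQ_apply, mulQuotient_mk, Submodule.Quotient.mk_eq_zero] at hy
  rw [Submodule.mkQ_apply, Submodule.Quotient.mk_eq_zero]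
  exact (hK y).mpr hy

theorem exact_mulQuotient {K J : Ideal R} {x : R} (hK : ∀ y, y ∈ K ↔ x * y ∈ J) :
    Function.Exact (mulQuotient hK)
      (Submodule.factor (le_sup_left : J ≤ J ⊔ Ideal.span {x})) := by
  intro y
  obtain ⟨y, rfl⟩ := Submodule.mkQ_surjective J y
  rw [Submodule.mkQ_apply]
  constructor
  · intro hy
    have hy : y ∈ J ⊔ Ideal.span {x} := by
      exact (Submodule.Quotient.mk_eq_zero _).mp hy
    obtain ⟨j, hj, w, hw, rfl⟩ := Submodule.mem_sup.mp hy
    obtain ⟨w, rfl⟩ := Ideal.mem_span_singleton'.mp hw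
    refine ⟨Submodule.Quotient.mk w, ?_⟩
    rw [mulQuotient_mk, Submodule.Quotient.eq]
    have : x * w - (j + w * x) = -j := by ring
    rw [this]
    exact J.neg_mem hj
  · rintro ⟨w, hw⟩
    obtain ⟨w, rfl⟩ := Submodule.mkQ_surjective K w
    rw [← hw, Submodule.mkQ_apply, mulQuotient_mk]
    refine (Submodule.Quotient.mk_eq_zero _).mpr ?_
    exact Submodule.mem_sup_right (Ideal.mul_mem_right _ _ (Ideal.mem_span_singleton_self x))

/-- If the elements of a maximal ideal `m` are null-homotopic on a flat differential module, and
its reduction modulo `m` is acyclic, then so are all its reductions. -/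
theorem exact_lTensor_quotient [IsNoetherianRing R] (hd : d ∘ₗ d = 0) (m : Ideal R) [m.IsMaximal]
    (hm : m ≤ nullHomotopyIdeal d)
    (h : Function.Exact (d.lTensor (R ⧸ m)) (d.lTensor (R ⧸ m))) (J : Ideal R) :
    Function.Exact (d.lTensor (R ⧸ J)) (d.lTensor (R ⧸ J)) := by
  induction J using IsNoetherian.induction with | hgt J ih =>
  by_cases hJ : J = ⊤
  · subst hJ
    have : Subsingleton (R ⧸ (⊤ : Ideal R)) := Ideal.Quotient.subsingleton_iff.mpr rfl
    exact fun y => ⟨fun _ => ⟨0, Subsingleton.elim _ _⟩, fun _ => Subsingleton.elim _ _⟩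
  by_cases hmJ : m ≤ J
  · obtain rfl := Ideal.IsMaximal.eq_of_le ‹_› hJ hmJ
    exact h
  obtain ⟨x, hxm, hxJ⟩ := SetLike.not_le_iff_exists.mp hmJ
  have hlt : J < J ⊔ Ideal.span {x} := by
    refine lt_of_le_of_ne le_sup_left fun heq => hxJ ?_
    rw [heq]
    exact Submodule.mem_sup_right (Ideal.mem_span_singleton_self x)
  -- By flatness, `0 → R/K → R/J → R/(J + (x)) → 0` stays exact after tensoring with `E`. If `K ≠
  -- J`, the induction hypothesis covers both outer terms. If `K = J`, it covers only the right one,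
  -- and the null-homotopy of `x ∈ m` replaces it on the left.
  let K : Ideal R := Submodule.comap (LinearMap.mulLeft R x) J
  have hJK : J ≤ K := fun y hy => Ideal.mul_mem_left J x hy
  have hinj {K : Ideal R} (hK : ∀ y, y ∈ K ↔ x * y ∈ J) :=
    Module.Flat.rTensor_preserves_injective_linearMap (M := E) _ (mulQuotient_injective hK)
  have hsurj := Submodule.factor_surjective (le_sup_left : J ≤ J ⊔ Ideal.span {x})
  have hex {K : Ideal R} (hK : ∀ y, y ∈ K ↔ x * y ∈ J) :=
    rTensor_exact E (exact_mulQuotient hK) hsurj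
  have hcomm {M N : Type _} [AddCommGroup M] [Module R M] [AddCommGroup N] [Module R N]
      (f : M →ₗ[R] N) : f.rTensor E ∘ₗ d.lTensor M = d.lTensor N ∘ₗ f.rTensor E := by
    rw [LinearMap.rTensor_comp_lTensor, LinearMap.lTensor_comp_rTensor]
  by_cases hKJ : K = J
  · have hK (y : R) : y ∈ J ↔ x * y ∈ J := by
      conv_lhs => rw [← hKJ]
      rfl
    have hd' := lTensor_comp_self (R ⧸ J) hd
    intro z
    refine ⟨fun hz => ?_, ?_⟩
    · obtain ⟨z', y, hz', rfl⟩ := exists_cycle_of_exact (hinj hK) (hex hK)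
        (LinearMap.rTensor_surjective E hsurj) (hcomm _) (hcomm _) hd' (ih _ hlt) hz
      obtain ⟨k, hk⟩ := hm hxm
      have hmul : mulQuotient hK = x • LinearMap.id := by
        refine LinearMap.ext fun w => ?_
        obtain ⟨w, rfl⟩ := Submodule.mkQ_surjective J w
        rfl
      -- The cycle is `x z'` plus a boundary, and `x z'` is the boundary of `k z'` because `z'` is a
      -- cycle.
      refine ⟨k.lTensor _ z' + y, ?_⟩
      have : d.lTensor (R ⧸ J) ∘ₗ k.lTensor (R ⧸ J) + k.lTensor (R ⧸ J) ∘ₗ d.lTensor (R ⧸ J)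
          = x • LinearMap.id := by
        rw [← LinearMap.lTensor_comp, ← LinearMap.lTensor_comp, ← LinearMap.lTensor_add, hk,
          LinearMap.lTensor_smul, LinearMap.lTensor_id]
      have := LinearMap.congr_fun this z'
      rw [LinearMap.add_apply, LinearMap.comp_apply, LinearMap.comp_apply, hz', map_zero,
        add_zero] at this
      rw [map_add, this, hmul, LinearMap.rTensor_smul, LinearMap.rTensor_id]
    · rintro ⟨y, rfl⟩
      exact LinearMap.congr_fun hd' y
  · exact exact_of_exact (hinj (K := K) fun _ => Iff.rfl) (hex fun _ => Iff.rfl)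
      (LinearMap.rTensor_surjective E hsurj) (hcomm _) (hcomm _) (lTensor_comp_self _ hd)
      (ih _ (lt_of_le_of_ne hJK (Ne.symm hKJ))) (ih _ hlt)

theorem exact_of_maximalIdeal_le [IsNoetherianRing R] (hd : d ∘ₗ d = 0) (m : Ideal R)
    [m.IsMaximal] (hm : m ≤ nullHomotopyIdeal d)
    (h : Function.Exact (d.lTensor (R ⧸ m)) (d.lTensor (R ⧸ m))) : Function.Exact d d := by
  let e : (R ⧸ (⊥ : Ideal R)) ⊗[R] E ≃ₗ[R] E :=
    (LinearEquiv.rTensor E (Submodule.quotEquivOfEqBot ⊥ rfl)) ≪≫ₗ TensorProduct.lid R E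
  have he : d ∘ₗ e.toLinearMap = e.toLinearMap ∘ₗ d.lTensor (R ⧸ (⊥ : Ideal R)) := by
    refine TensorProduct.ext' fun x y => ?_
    simp [e]
  exact Function.Exact.of_ladder_linearEquiv_of_exact he he (exact_lTensor_quotient hd m hm h ⊥)

end Devissage

-- Lifting acyclicity from the residue field

universe v

/-- A projective module with a differentiation of finitely generated homology over a noetherian
local ring is acyclic if its reduction to the residue field is. -/
theorem exact_of_exact_residueField {A : Type*} [CommRing A] [IsNoetherianRing A] [IsLocalRing A]
    (E : Type v) [AddCommGroup E] [Module A E] [Module.Projective A E]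
    (d : E →ₗ[A] E) (hd : d ∘ₗ d = 0) (hL : HomologyFG d)
    (h : Function.Exact (d.lTensor (A ⧸ IsLocalRing.maximalIdeal A))
      (d.lTensor (A ⧸ IsLocalRing.maximalIdeal A))) : Function.Exact d d := by
  generalize hI : nullHomotopyIdeal d = I
  -- The module varies in the induction, since the step passes from `E` to its cone `E × E`.
  induction I using IsNoetherian.induction generalizing E with | hgt I ih =>
  subst hI
  by_cases hm : IsLocalRing.maximalIdeal A ≤ nullHomotopyIdeal d
  · exact exact_of_maximalIdeal_le hd _ hm h
  obtain ⟨x, hxm, hx⟩ := SetLike.not_le_iff_exists.mp hm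
  have hlt : nullHomotopyIdeal d < nullHomotopyIdeal (cone d x) :=
    lt_of_le_of_ne (nullHomotopyIdeal_le_cone d x)
      fun heq => hx (heq ▸ mem_nullHomotopyIdeal_cone d x)
  have hcone := ih _ hlt (E × E) (cone d x) (cone_comp_cone hd x) (hL.cone hd x)
    (exact_lTensor_cone _ hd x h) rfl
  obtain ⟨L, hLfg, hLk, hkL⟩ := hL
  -- Writing `(l, 0)` as a boundary of the cone gives `l = d a + x b` with `b` a cycle, so `L` lies
  -- in `Im d + m L`. Nakayama only needs `L` to be finitely generated, not `E`.
  have key : L ≤ LinearMap.range d := by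
    refine Submodule.le_of_le_smul_of_le_jacobson_bot hLfg
      (IsLocalRing.jacobson_eq_maximalIdeal ⊥ bot_ne_top).ge fun l hl => ?_
    have hl0 : d l = 0 := hLk hl
    obtain ⟨⟨a, b⟩, hab⟩ := (hcone (l, 0)).mp (by simp [cone_apply, hl0])
    simp only [cone_apply, Prod.mk.injEq, neg_eq_zero] at hab
    obtain ⟨l', hl', _, ⟨y, rfl⟩, rfl⟩ := Submodule.mem_sup.mp (hkL hab.2)
    rw [← hab.1, smul_add, add_comm (x • l'), ← add_assoc, ← map_smul, ← map_add]
    exact Submodule.add_mem_sup ⟨_, rfl⟩ (Submodule.smul_mem_smul hxm hl')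
  intro z
  refine ⟨fun hz => ?_, ?_⟩
  · exact (hkL.trans (sup_le key le_rfl)) hz
  · rintro ⟨y, rfl⟩
    exact LinearMap.congr_fun hd y

end Differentiation

namespace Differentiation

/-! ### Support of homology and localization -/

section Support

variable {S : Type*} [CommRing S] {X : Type*} [AddCommGroup X] [Module S X]

theorem notMem_support_homology_iff (δ : Differentiation S X) (q : PrimeSpectrum S) :
    q ∉ Module.support S δ.Homology ↔ ∀ z, δ.toLinearMap z = 0 →
      ∃ r ∈ q.asIdeal.primeCompl, ∃ y, r • z = δ.toLinearMap y := by
  rw [Module.notMem_support_iff']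
  constructor
  · intro h z hz
    obtain ⟨r, hr, hrz⟩ := h (Submodule.Quotient.mk ⟨z, hz⟩)
    rw [← Submodule.Quotient.mk_smul, Submodule.Quotient.mk_eq_zero] at hrz
    obtain ⟨y, hy⟩ := hrz
    exact ⟨r, hr, y, hy.symm⟩
  · intro h m
    obtain ⟨⟨z, hz⟩, rfl⟩ := Submodule.mkQ_surjective _ m
    obtain ⟨r, hr, y, hy⟩ := h z hz
    refine ⟨r, hr, ?_⟩
    rw [Submodule.mkQ_apply, ← Submodule.Quotient.mk_smul, Submodule.Quotient.mk_eq_zero]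
    exact ⟨y, hy.symm⟩

/-- The map `d'` is a bare function compatible with scalars because it is applied to maps given as
`R`-linear on modules localized over `S`; clearing denominators needs nothing more. -/
theorem exact_iff_of_isLocalizedModule (W : Submonoid S) {X' : Type*} [AddCommGroup X']
    [Module S X'] (f : X →ₗ[S] X') [IsLocalizedModule W f] {d : X →ₗ[S] X} {d' : X' → X'}
    (hsmul : ∀ (s : S) x, d' (s • x) = s • d' x)
    (hd : d ∘ₗ d = 0) (hf : ∀ x, d' (f x) = f (d x)) :
    Function.Exact d' d' ↔ ∀ z, d z = 0 → ∃ r ∈ W, ∃ y, r • z = d y := by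
  have hd (x : X) : d (d x) = 0 := LinearMap.congr_fun hd x
  constructor
  · intro h z hz
    obtain ⟨y', hy'⟩ := (h (f z)).mp (by rw [hf, hz, map_zero])
    obtain ⟨⟨y, s⟩, hy⟩ := IsLocalizedModule.surj W f y'
    obtain ⟨c, hc⟩ := IsLocalizedModule.exists_of_eq (S := W) (f := f) (x₁ := (s : S) • z)
      (x₂ := d y) (by rw [map_smul, ← hy', ← hsmul, ← hf]; exact congrArg d' hy)
    refine ⟨c * s, W.mul_mem c.2 s.2, (c : S) • y, ?_⟩
    rw [mul_smul, map_smul]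
    exact hc
  · intro h z
    constructor
    · intro hz
      obtain ⟨⟨x, s⟩, hx⟩ := IsLocalizedModule.surj W f z
      have hx : (s : S) • z = f x := hx
      obtain ⟨c, hc⟩ := IsLocalizedModule.exists_of_eq (S := W) (f := f) (x₁ := d x)
        (x₂ := 0) (by rw [← hf, ← hx, hsmul, hz, smul_zero, map_zero])
      have hc : (c : S) • d x = (c : S) • 0 := hc
      obtain ⟨r, hr, y, hy⟩ := h ((c : S) • x) (by rw [map_smul, hc, smul_zero])
      let t : W := ⟨r, hr⟩ * c * s
      refine ⟨IsLocalizedModule.mk' f y t, IsLocalizedModule.smul_injective f t ?_⟩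
      have h1 : t • d' (IsLocalizedModule.mk' f y t) = f (d y) := by
        rw [← hf, ← IsLocalizedModule.mk'_cancel' f y t]
        exact (hsmul _ _).symm
      change t • d' (IsLocalizedModule.mk' f y t) = t • z
      rw [h1, ← hy, map_smul, map_smul, ← hx, smul_smul, smul_smul]
      rfl
    · rintro ⟨y, rfl⟩
      obtain ⟨⟨x, s⟩, hx⟩ := IsLocalizedModule.surj W f y
      have hx : (s : S) • y = f x := hx
      apply IsLocalizedModule.smul_injective f s
      change (s : S) • d' (d' y) = (s : S) • (0 : X')
      rw [← hsmul, ← hsmul, hx, hf, hf, hd, map_zero, smul_zero]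

theorem homologyFG_of_finite (δ : Differentiation S X) [h : Module.Finite S δ.Homology] :
    HomologyFG δ.toLinearMap := by
  classical
  obtain ⟨t, ht⟩ := h.fg_top
  obtain ⟨t', -, ht'⟩ := Finset.subset_set_image_iff (f := Submodule.Quotient.mk
    (p := δ.boundaries.submoduleOf δ.cycles)) (s := Set.univ) (t := t) |>.mp
    (fun x _ => by simpa using Submodule.mkQ_surjective _ x)
  let L := Submodule.span S (t' : Set δ.cycles)
  refine ⟨L.map δ.cycles.subtype, Submodule.FG.map _ ⟨t', rfl⟩, ?_, fun z hz => ?_⟩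
  · rintro _ ⟨z, -, rfl⟩
    exact z.2
  · have : Submodule.Quotient.mk ⟨z, hz⟩ ∈
        L.map (δ.boundaries.submoduleOf δ.cycles).mkQ := by
      have hL : L.map (δ.boundaries.submoduleOf δ.cycles).mkQ = ⊤ := by
        rw [← ht, ← ht', Submodule.map_span, Finset.coe_image]
        rfl
      rw [hL]
      trivial
    obtain ⟨l, hl, hlz⟩ := this
    have hlz := (Submodule.Quotient.eq _).mp hlz
    obtain ⟨y, hy⟩ := hlz
    have hy : δ.toLinearMap y = l - z := hy
    refine Submodule.mem_sup.mpr ⟨l, ⟨l, hl, rfl⟩, δ.toLinearMap (-y), ⟨_, rfl⟩, ?_⟩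
    rw [map_neg, hy]
    abel

end Support

/-! ### Base change of acyclicity -/

section BaseChange

variable {R : Type*} [CommRing R] {D : Type*} [AddCommGroup D] [Module R D] {d : D →ₗ[R] D}

theorem HomologyFG.baseChange (W : Submonoid R) (A : Type*) [CommRing A] [Algebra R A]
    [IsLocalization W A] (h : HomologyFG d) : HomologyFG (d.baseChange A) := by
  obtain ⟨L, ⟨t, ht⟩, hLk, hkL⟩ := h
  let f : D →ₗ[R] A ⊗[R] D := TensorProduct.mk R A D 1
  have hf (x : D) : d.baseChange A (f x) = f (d x) := rfl
  refine ⟨L.baseChange A, ?_, ?_, ?_⟩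
  · classical
    refine ⟨t.image f, ?_⟩
    rw [← ht, Submodule.baseChange_span, Finset.coe_image]
  · rw [Submodule.baseChange_eq_span, Submodule.span_le]
    rintro _ ⟨l, hl, rfl⟩
    have : d l = 0 := hLk hl
    change d.baseChange A (f l) = 0
    rw [hf, this, map_zero]
  · intro z hz
    obtain ⟨⟨x, s⟩, hx⟩ := IsLocalizedModule.surj W f z
    have hx : (s : R) • z = f x := hx
    obtain ⟨c, hc⟩ := IsLocalizedModule.exists_of_eq (S := W) (f := f) (x₁ := d x)
      (x₂ := 0) (by
        rw [← hf, ← hx, LinearMap.map_smul_of_tower, LinearMap.mem_ker.mp hz, smul_zero, map_zero])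
    have hc : (c : R) • d x = (c : R) • 0 := hc
    obtain ⟨l, hl, _, ⟨y, rfl⟩, hly⟩ := Submodule.mem_sup.mp
      (hkL (show d ((c : R) • x) = 0 by rw [map_smul, hc, smul_zero]))
    have hu : IsUnit (algebraMap R A (c * s : W)) := IsLocalization.map_units A (c * s)
    rw [← Submodule.smul_mem_iff_of_isUnit _ hu, algebraMap_smul]
    have : ((c * s : W) : R) • z = f l + d.baseChange A (f y) := by
      rw [hf, ← map_add, hly, map_smul, ← hx, smul_smul]
      rfl
    rw [this]
    exact Submodule.add_mem_sup (Submodule.tmul_mem_baseChange_of_mem 1 hl) ⟨_, rfl⟩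

theorem exact_of_homotopy {A : Type*} [AddCommGroup A] [Module R A] {a h : A →ₗ[R] A}
    (ha : a ∘ₗ a = 0) (hh : a ∘ₗ h + h ∘ₗ a = LinearMap.id) : Function.Exact a a := by
  intro z
  refine ⟨fun hz => ⟨h z, ?_⟩, ?_⟩
  · have := LinearMap.congr_fun hh z
    rwa [LinearMap.add_apply, LinearMap.comp_apply, LinearMap.comp_apply, hz, map_zero,
      add_zero] at this
  · rintro ⟨y, rfl⟩
    exact LinearMap.congr_fun ha y

/-- If `D → T ⊗ D` is null-homotopic, then `M ⊗ D` is contractible for every `T`-module `M`. -/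
theorem exact_lTensor_of_homotopy (hd : d ∘ₗ d = 0) (T : Type*) [CommRing T] [Algebra R T]
    (h : D →ₗ[R] T ⊗[R] D)
    (hh : d.lTensor T ∘ₗ h + h ∘ₗ d = TensorProduct.mk R T D 1)
    (M : Type*) [AddCommGroup M] [Module R M] [Module T M] [IsScalarTower R T M] :
    Function.Exact (d.lTensor M) (d.lTensor M) := by
  -- `Φ m` sends `t ⊗ x` to `t m ⊗ x`, so that `m ⊗ x ↦ Φ m (h x)` extends `h` to a contraction of
  -- `M ⊗ D`.
  let Φ : M →ₗ[R] (T ⊗[R] D →ₗ[R] M ⊗[R] D) :=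
    LinearMap.rTensorHom D ∘ₗ (Algebra.lsmul R R M : T →ₐ[R] Module.End R M).toLinearMap.flip
  have hΦ (m : M) : d.lTensor M ∘ₗ Φ m = Φ m ∘ₗ d.lTensor T :=
    TensorProduct.ext' fun t x => rfl
  let k : M ⊗[R] D →ₗ[R] M ⊗[R] D := TensorProduct.lift (LinearMap.lcomp R _ h ∘ₗ Φ)
  have hk (m : M) (x : D) : k (m ⊗ₜ x) = Φ m (h x) := rfl
  refine exact_of_homotopy (h := k) (lTensor_comp_self M hd) (TensorProduct.ext' fun m x => ?_)
  have h1 : d.lTensor T (h x) + h (d x) = 1 ⊗ₜ x := LinearMap.congr_fun hh x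
  have h2 : d.lTensor M (Φ m (h x)) = Φ m (d.lTensor T (h x)) := LinearMap.congr_fun (hΦ m) (h x)
  rw [LinearMap.add_apply, LinearMap.comp_apply, LinearMap.comp_apply, hk, LinearMap.lTensor_tmul,
    hk, h2, ← map_add, h1]
  change ((1 : T) • m) ⊗ₜ[R] x = m ⊗ₜ x
  rw [one_smul]

/-- The morphism `x ↦ 1 ⊗ x` into the acyclic module `T ⊗ D` is null-homotopic. No flatness of `M`
over `T` is needed. -/
theorem IsRetract.exact_lTensor {F : Type*} [AddCommGroup F] [Module R F]
    {δ : Differentiation R D} {ε : Differentiation R F} (hret : δ.IsRetract ε)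
    (hε : ε.AdmitsProjectiveFlag) (T : Type*) [CommRing T] [Algebra R T]
    (hT : Function.Exact (δ.toLinearMap.lTensor T) (δ.toLinearMap.lTensor T))
    (M : Type*) [AddCommGroup M] [Module R M] [Module T M] [IsScalarTower R T M] :
    Function.Exact (δ.toLinearMap.lTensor M) (δ.toLinearMap.lTensor M) := by
  obtain ⟨h, hh⟩ := hret.exists_homotopy hε _ hT (TensorProduct.mk R T D 1) rfl
  exact exact_lTensor_of_homotopy δ.sq_zero T h hh M

/-- A splitting of `M` off `N` makes `M ⊗ D` a direct summand of `N ⊗ D` as a differential module.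
-/
theorem exact_lTensor_of_leftInverse {M N : Type*} [AddCommGroup M] [Module R M] [AddCommGroup N]
    [Module R N] (hd : d ∘ₗ d = 0) (i : M →ₗ[R] N) (r : N →ₗ[R] M) (hri : r ∘ₗ i = LinearMap.id)
    (h : Function.Exact (d.lTensor N) (d.lTensor N)) :
    Function.Exact (d.lTensor M) (d.lTensor M) := by
  intro z
  refine ⟨fun hz => ?_, ?_⟩
  · obtain ⟨w, hw⟩ := (h (i.rTensor D z)).mp (by
      rw [← LinearMap.comp_apply, LinearMap.lTensor_comp_rTensor,
        ← LinearMap.rTensor_comp_lTensor, LinearMap.comp_apply, hz, map_zero])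
    refine ⟨r.rTensor D w, ?_⟩
    rw [← LinearMap.comp_apply, LinearMap.lTensor_comp_rTensor, ← LinearMap.rTensor_comp_lTensor,
      LinearMap.comp_apply, hw, ← LinearMap.rTensor_comp_apply, hri, LinearMap.rTensor_id_apply]
  · rintro ⟨y, rfl⟩
    exact LinearMap.congr_fun (lTensor_comp_self M hd) y

theorem notMem_support_homology_iff_exact (δ : Differentiation R D) (p : PrimeSpectrum R) :
    p ∉ Module.support R δ.Homology ↔
      Function.Exact (δ.toLinearMap.lTensor (Localization.AtPrime p.asIdeal))
        (δ.toLinearMap.lTensor (Localization.AtPrime p.asIdeal)) := by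
  rw [notMem_support_homology_iff, ← exact_iff_of_isLocalizedModule p.asIdeal.primeCompl
    (TensorProduct.mk R (Localization.AtPrime p.asIdeal) D 1)
    (d' := δ.toLinearMap.lTensor (Localization.AtPrime p.asIdeal)) (map_smul _) δ.sq_zero
    fun x => rfl]

theorem notMem_support_homology_baseChange_iff_exact {S : Type*} [CommRing S] [Algebra R S]
    (δ : Differentiation R D) (q : PrimeSpectrum S) :
    q ∉ Module.support S (δ.baseChange S).Homology ↔
      Function.Exact (δ.toLinearMap.lTensor (Localization.AtPrime q.asIdeal))
        (δ.toLinearMap.lTensor (Localization.AtPrime q.asIdeal)) := by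
  let f := TensorProduct.AlgebraTensorModule.rTensor R D
    (Algebra.linearMap S (Localization.AtPrime q.asIdeal))
  rw [notMem_support_homology_iff, ← exact_iff_of_isLocalizedModule q.asIdeal.primeCompl f
    (d' := δ.toLinearMap.lTensor (Localization.AtPrime q.asIdeal)) ?_
    (δ.baseChange S).sq_zero ?_]
  · exact (TensorProduct.AlgebraTensorModule.lTensor S (Localization.AtPrime q.asIdeal)
      δ.toLinearMap).map_smul
  · intro x
    change (δ.toLinearMap.lTensor _ ∘ₗ f.restrictScalars R) x =
      (f.restrictScalars R ∘ₗ δ.toLinearMap.lTensor S) x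
    congr 1
    exact TensorProduct.ext' fun s x => rfl

end BaseChange

/-! ### Comparison of supports along `Spec S → Spec R` -/

section Main

variable {R : Type*} [CommRing R] {S : Type*} [CommRing S] [Algebra R S]
  {D : Type*} [AddCommGroup D] [Module R D] {δ : Differentiation R D}
  {F : Type*} [AddCommGroup F] [Module R F] {ε : Differentiation R F}

theorem IsRetract.comap_mem_support (hret : δ.IsRetract ε) (hε : ε.AdmitsProjectiveFlag)
    {q : PrimeSpectrum S} (hq : q ∈ Module.support S (δ.baseChange S).Homology) :
    q.comap (algebraMap R S) ∈ Module.support R δ.Homology := by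
  contrapose! hq
  rw [notMem_support_homology_iff_exact] at hq
  rw [notMem_support_homology_baseChange_iff_exact]
  let p := q.comap (algebraMap R S)
  let φ := Localization.localRingHom p.asIdeal q.asIdeal (algebraMap R S) rfl
  let : Algebra (Localization.AtPrime p.asIdeal) (Localization.AtPrime q.asIdeal) := φ.toAlgebra
  have : IsScalarTower R (Localization.AtPrime p.asIdeal) (Localization.AtPrime q.asIdeal) :=
    .of_algebraMap_eq fun x => by
      rw [RingHom.algebraMap_toAlgebra, IsScalarTower.algebraMap_apply R S]
      exact (Localization.localRingHom_to_map _ _ _ _ x).symm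
  exact hret.exact_lTensor hε (Localization.AtPrime p.asIdeal) hq _

theorem IsRetract.mem_support [IsNoetherianRing R] (hret : δ.IsRetract ε)
    (hε : ε.AdmitsProjectiveFlag) (hH : Module.Finite R δ.Homology) {q : PrimeSpectrum S}
    (hq : q.comap (algebraMap R S) ∈ Module.support R δ.Homology) :
    q ∈ Module.support S (δ.baseChange S).Homology := by
  contrapose! hq
  rw [notMem_support_homology_baseChange_iff_exact] at hq
  rw [notMem_support_homology_iff_exact]
  set p := q.comap (algebraMap R S)
  have hκq := hret.exact_lTensor hε (Localization.AtPrime q.asIdeal) hq q.asIdeal.ResidueField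
  let φ : p.asIdeal.ResidueField →ₐ[R] q.asIdeal.ResidueField :=
    Ideal.ResidueField.mapₐ p.asIdeal q.asIdeal (Algebra.ofId R S) rfl
  have hκp : Function.Exact (δ.toLinearMap.lTensor p.asIdeal.ResidueField)
      (δ.toLinearMap.lTensor p.asIdeal.ResidueField) := by
    let : Algebra p.asIdeal.ResidueField q.asIdeal.ResidueField := φ.toRingHom.toAlgebra
    have : IsScalarTower R p.asIdeal.ResidueField q.asIdeal.ResidueField :=
      .of_algebraMap_eq fun x => (φ.commutes x).symm
    -- An extension of fields splits linearly over the smaller field.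
    obtain ⟨r, hr⟩ := (Algebra.linearMap p.asIdeal.ResidueField
      q.asIdeal.ResidueField).exists_leftInverse_of_injective
      (LinearMap.ker_eq_bot.mpr (algebraMap p.asIdeal.ResidueField q.asIdeal.ResidueField).injective)
    exact exact_lTensor_of_leftInverse δ.sq_zero φ.toLinearMap (r.restrictScalars R)
      (LinearMap.ext fun x => LinearMap.congr_fun hr x) hκq
  let A := Localization.AtPrime p.asIdeal
  have := hret.projective hε
  -- Reducing `R_p ⊗ D` modulo the maximal ideal gives `κ(p) ⊗ D`, compatibly with the
  -- differentiations; `κ(p)` is by definition that quotient of `R_p`.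
  let e := (TensorProduct.AlgebraTensorModule.cancelBaseChange R A A p.asIdeal.ResidueField D)
  have he : e.toLinearMap ∘ₗ (δ.toLinearMap.baseChange A).lTensor p.asIdeal.ResidueField =
      TensorProduct.AlgebraTensorModule.lTensor A p.asIdeal.ResidueField δ.toLinearMap ∘ₗ
        e.toLinearMap := by
    ext
    rfl
  refine exact_of_exact_residueField (A := A) (A ⊗[R] D) (δ.toLinearMap.baseChange A)
    (δ.baseChange A).sq_zero
    ((homologyFG_of_finite δ).baseChange p.asIdeal.primeCompl A) ?_
  exact (Function.Exact.iff_of_ladder_linearEquiv he.symm he.symm).mp hκp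

end Main

end Differentiation

/-! ### Finite length and artinian quotients -/

/-- A finite module over a noetherian ring has finite length if and only if the quotient
of the ring by its annihilator is artinian. -/
theorem isFiniteLength_iff_isArtinianRing_quotient_annihilator {S : Type*} [CommRing S]
    [IsNoetherianRing S] (M : Type*) [AddCommGroup M] [Module S M] [Module.Finite S M] :
    IsFiniteLength S M ↔ IsArtinianRing (S ⧸ Module.annihilator S M) := by
  rw [isFiniteLength_iff_isNoetherian_isArtinian]
  constructor
  · rintro ⟨-, h⟩
    obtain ⟨n, s, hs⟩ := Module.Finite.exists_fin (R := S) (M := M)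
    -- Evaluation at `n` generators has kernel the annihilator, so it embeds the quotient ring in
    -- the artinian module `Mⁿ`.
    let f : S →ₗ[S] (Fin n → M) := LinearMap.pi fun i => LinearMap.toSpanSingleton S M (s i)
    have hf : LinearMap.ker f = Module.annihilator S M := by
      ext x
      rw [LinearMap.mem_ker, ← Submodule.annihilator_top, ← hs, Submodule.mem_annihilator_span]
      constructor
      · rintro hx ⟨_, i, rfl⟩
        exact congrFun hx i
      · intro hx
        funext i
        exact hx ⟨_, i, rfl⟩
    have : IsArtinian S (S ⧸ Module.annihilator S M) := by
      rw [← hf]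
      exact isArtinian_of_injective _ f.quotKerEquivRange.injective
    exact isArtinian_of_tower S this
  · intro h
    refine ⟨inferInstance, ?_⟩
    let : Module (S ⧸ Module.annihilator S M) M := Module.quotientAnnihilator
    have : Module.Finite (S ⧸ Module.annihilator S M) M :=
      Module.Finite.of_restrictScalars_finite S _ _
    have hM : IsArtinian (S ⧸ Module.annihilator S M) M := inferInstance
    have hsurj : Function.Surjective (algebraMap S (S ⧸ Module.annihilator S M)) :=
      Ideal.Quotient.mk_surjective
    exact isArtinian_of_surjective_algebraMap hsurj

/-- A noetherian ring is artinian exactly in Krull dimension zero. The criterion sees only `V(J)`,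
which allows the annihilator of the homology to be exchanged for `IS`. -/
theorem isArtinianRing_quotient_iff {S : Type*} [CommRing S] [IsNoetherianRing S] (J : Ideal S) :
    IsArtinianRing (S ⧸ J) ↔ ∀ q ∈ PrimeSpectrum.zeroLocus (J : Set S), q.asIdeal.IsMaximal := by
  rw [isArtinianRing_iff_krullDimLE_zero, Ring.krullDimLE_zero_iff]
  constructor
  · intro h q hq
    have hker : RingHom.ker (Ideal.Quotient.mk J) ≤ q.asIdeal := by
      rw [Ideal.mk_ker]; exact hq
    have := Ideal.map_isPrime_of_surjective (Ideal.Quotient.mk_surjective (I := J)) hker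
    have := Ideal.comap_isMaximal_of_surjective (Ideal.Quotient.mk J)
      Ideal.Quotient.mk_surjective (H := h _ this)
    rwa [Ideal.comap_map_of_surjective' _ Ideal.Quotient.mk_surjective, sup_eq_left.mpr hker]
      at this
  · intro h P hP
    have hmax := h ⟨P.comap (Ideal.Quotient.mk J), inferInstance⟩ fun x hx => by
      change Ideal.Quotient.mk J x ∈ P
      rw [Ideal.Quotient.eq_zero_iff_mem.mpr hx]
      exact P.zero_mem
    have := Ideal.map_eq_top_or_isMaximal_of_surjective (Ideal.Quotient.mk J)
      Ideal.Quotient.mk_surjective hmax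
    rw [Ideal.map_comap_of_surjective _ Ideal.Quotient.mk_surjective] at this
    exact this.resolve_left hP.ne_top

theorem mainTheorem7
    {R : Type*} [CommRing R] [IsNoetherianRing R]
    {S : Type*} [CommRing S] [IsNoetherianRing S] [Algebra R S]
    {D : Type*} [AddCommGroup D] [Module R D] (δ : Differentiation R D)
    (hH : Module.Finite R δ.Homology)
    {F : Type*} [AddCommGroup F] [Module R F] (ε : Differentiation R F)
    (hret : δ.IsRetract ε) (hflag : ε.AdmitsProjectiveFlag)
    (I : Ideal R) (hI : I = Module.annihilator R δ.Homology) :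
    Module.support S (δ.baseChange S).Homology
        = Module.support S (S ⧸ I.map (algebraMap R S)) ∧
      (Module.Finite S (S ⊗[R] D) →
        (IsFiniteLength S (δ.baseChange S).Homology ↔
          IsArtinianRing (S ⧸ I.map (algebraMap R S)))) := by
  have hsupp : Module.support S (δ.baseChange S).Homology
      = Module.support S (S ⧸ I.map (algebraMap R S)) := by
    ext q
    have h1 : q ∈ Module.support S (δ.baseChange S).Homology ↔
        q.comap (algebraMap R S) ∈ Module.support R δ.Homology :=
      ⟨hret.comap_mem_support hflag, hret.mem_support hflag hH⟩
    rw [h1, Module.support_eq_zeroLocus, Module.support_eq_zeroLocus, Ideal.annihilator_quotient,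
      ← hI, PrimeSpectrum.mem_zeroLocus, PrimeSpectrum.mem_zeroLocus, SetLike.coe_subset_coe,
      SetLike.coe_subset_coe, Ideal.map_le_iff_le_comap]
    rfl
  refine ⟨hsupp, fun hfin => ?_⟩
  rw [isFiniteLength_iff_isArtinianRing_quotient_annihilator, isArtinianRing_quotient_iff,
    isArtinianRing_quotient_iff, ← Module.support_eq_zeroLocus, hsupp, Module.support_eq_zeroLocus,
    Ideal.annihilator_quotient]
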